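/- Let $\Bbbk$ be a field, let $G$ be a finite simple graph with vertices $x_1,\dots,x_n$ and edges $e_1,\dots,e_r$, and let $R=\Bbbk[x_1,\dots,x_n]$. Let $I=I(G)=(f_1,\dots,f_r)\subseteq R$ be the edge ideal of $G$, where $f_i=x_ax_b$ if $e_i=\{x_a,x_b\}$. Let $J$ be the defining ideal of the Rees algebra $R[It]\subseteq R[t]$, that is, the kernel of the $R$-algebra homomorphism $R[T_1,\dots,T_r]\to R[It]$ with $T_i\mapsto f_it$. Let $\phi$ be the presentation matrix of $I$ from its Taylor resolution: its rows are indexed by $1,\dots,r$, its columns by the two-element subsets $\tau\subseteq\{1,\dots,r\}$, and its $(j,\tau)$ entry is $0$ if $j\notin\tau$, is $-\operatorname{lcm}(f_j,f_l)/f_j$ if $\tau=\{j,l\}$ with $j<l$, and is $\operatorname{lcm}(f_j,f_l)/f_j$ if $\tau=\{j,l\}$ with $j>l$. Write $\mathbf T=[T_1\ \cdots\ T_r]$. Let $B(\phi)$ be a Jacobian dual of $\phi$, that is, any matrix with entries in $R[T_1,\dots,T_r]$ that are linear forms in $T_1,\dots,T_r$ with coefficients in $R$, such that $\mathbf T\cdot\phi=[x_1\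 \cdots\ x_n]\cdot B(\phi)$. Let $\overline{B(\phi)}$ be the reduced Jacobian dual, the matrix over $\Bbbk[T_1,\dots,T_r]\subseteq R[T_1,\dots,T_r]$ obtained by reducing $B(\phi)$ modulo $(x_1,\dots,x_n)$, and let $k=\operatorname{rank}\overline{B(\phi)}$. For each $t$ let $\operatorname{bi}(I_t(\overline{B(\phi)}))$ be the set of those $t\times t$ minors of $\overline{B(\phi)}$ that are binomials, i.e. of the form $\pm m_1\pm m_2$ with distinct monomials $m_1\ne m_2$ in $T_1,\dots,T_r$. Then $J$ is the ideal of $R[T_1,\dots,T_r]$ generated by the entries of $\mathbf T\cdot\phi$ and all binomial $t\times t$ minors of $\overline{B(\phi)}$ with $2\le t\le k$: $$J=\big\langle \mathbf T\cdot\phi,\ \operatorname{bi}(I_2(\overline{B(\phi)})),\ \operatorname{bi}(I_3(\overline{B(\phi)})),\ \dots,\ \operatorname{bi}(I_k(\overline{B(\phi)}))\big\rangle .$$ -/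

import Mathlib

open MvPolynomial

noncomputable section

/-- The exponent vector of the monomial `x_a x_b` attached to the pair `s(a, b)`. -/
def edgeExponent {V : Type*} (e : Sym2 V) : V →₀ ℕ :=
  Sym2.lift ⟨fun a b => Finsupp.single a 1 + Finsupp.single b 1, fun _ _ => add_comm _ _⟩ e

/-- The edge ideal `I(G)` in `k[x_v : v ∈ V]`, generated by the `x_a x_b` with `ab` an edge. -/
def edgeIdeal (k : Type*) [Field k] {V : Type*} (G : SimpleGraph V) : Ideal (MvPolynomial V k) :=
  Ideal.span {p | ∃ a b, G.Adj a b ∧ p = X a * X b}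

/-- The generator `f_i` of `I(G)`, for an enumeration `e` of the edges of `G`. -/
def edgeGenerator (k : Type*) [Field k] {V : Type*} {G : SimpleGraph V} {r : ℕ}
    (e : Fin r ≃ G.edgeSet) (i : Fin r) : MvPolynomial V k :=
  monomial (edgeExponent (e i : Sym2 V)) 1

theorem edgeGenerator_mem (k : Type*) [Field k] {V : Type*} {G : SimpleGraph V} {r : ℕ}
    (e : Fin r ≃ G.edgeSet) (i : Fin r) : edgeGenerator k e i ∈ edgeIdeal k G := by
  unfold edgeGenerator
  obtain ⟨s, hs⟩ := e i
  induction s with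
  | _ a b =>
    refine Ideal.subset_span ⟨a, b, hs, ?_⟩
    simp [edgeExponent, X, monomial_mul]

/-- For elements `f_i` of an ideal `I` of `R`, the map `θ : R[T_i] → R[It]`, `T_i ↦ f_i t`,
to the Rees algebra. -/
def reesPresentation {R : Type*} [CommRing R] (I : Ideal R) {ι : Type*} (f : ι → R)
    (hf : ∀ i, f i ∈ I) : MvPolynomial ι R →ₐ[R] reesAlgebra I :=
  aeval fun i => ⟨Polynomial.monomial 1 (f i), by
    rw [reesAlgebra.monomial_mem, pow_one]
    exact hf i⟩

/-- The defining ideal `J = ker θ` of the Rees algebra of `I(G)`. -/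
def reesDefiningIdeal (k : Type*) [Field k] {V : Type*} {G : SimpleGraph V} {r : ℕ}
    (e : Fin r ≃ G.edgeSet) : Ideal (MvPolynomial (Fin r) (MvPolynomial V k)) :=
  RingHom.ker (reesPresentation (edgeIdeal k G) (edgeGenerator k e) (edgeGenerator_mem k e))

/-- The Taylor presentation matrix (the matrix of `F₂ → F₁` in the Taylor resolution) of the
monomials `f_i = x ^ m_i`.  Its columns are indexed by the two-element subsets `τ` of indices; the
exponent of `f_τ = lcm (f_i : i ∈ τ)` is the coordinatewise supremum of the `m_i`.  The entry at
`(j, τ)` is `0` if `j ∉ τ`, and for `τ = {j, l}` it is `- f_τ / f_j` if `j < l` and `f_τ / f_j`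
if `j > l`. -/
def taylorPresentationMatrix (k : Type*) [Field k] {V : Type*} {r : ℕ} (m : Fin r → V →₀ ℕ) :
    Matrix (Fin r) {τ : Finset (Fin r) // τ.card = 2} (MvPolynomial V k) :=
  Matrix.of fun j τ =>
    if j ∈ τ.1 then
      if ∃ l ∈ τ.1, j < l then -monomial (τ.1.sup m - m j) 1 else monomial (τ.1.sup m - m j) 1
    else 0

/-- The Taylor presentation matrix `φ` of the edge ideal `I(G)`. -/
def edgeTaylorMatrix (k : Type*) [Field k] {V : Type*} {G : SimpleGraph V} {r : ℕ}
    (e : Fin r ≃ G.edgeSet) :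
    Matrix (Fin r) {τ : Finset (Fin r) // τ.card = 2} (MvPolynomial V k) :=
  taylorPresentationMatrix k fun i => edgeExponent (e i : Sym2 V)

/-- The row `[T_1 ⋯ T_r] · φ`, with entries in `R[T_1, …, T_r]`. -/
def linearForms {R : Type*} [CommRing R] {r : ℕ} {κ : Type*} (φ : Matrix (Fin r) κ R) :
    κ → MvPolynomial (Fin r) R :=
  Matrix.vecMul (fun i => X i) (φ.map C)

/-- `B` is a Jacobian dual of `φ`: its entries are linear in the variables `T_i`, and
`[T_1 ⋯ T_r] · φ = [x_1 ⋯ x_n] · B`. -/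
structure IsJacobianDual {k : Type*} [Field k] {V : Type*} [Fintype V] {r : ℕ} {κ : Type*}
    (φ : Matrix (Fin r) κ (MvPolynomial V k))
    (B : Matrix V κ (MvPolynomial (Fin r) (MvPolynomial V k))) : Prop where
  linear : ∀ v c, (B v c).IsHomogeneous 1
  eq : linearForms φ = Matrix.vecMul (fun v : V => C (X v)) B

/-- Reduction of a matrix over `R[T]` modulo `𝔪 = (x_v : v ∈ V)`, where `R / 𝔪` is identified
with `k` through the constant coefficient. -/
def reducedMatrix {k : Type*} [Field k] {V κ : Type*} {r : ℕ}
    (B : Matrix V κ (MvPolynomial (Fin r) (MvPolynomial V k))) :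
    Matrix V κ (MvPolynomial (Fin r) k) :=
  B.map (MvPolynomial.map constantCoeff)

/-- A binomial: a sum or difference, up to sign, of two distinct monomials. -/
def IsBinomial {k : Type*} [Field k] {σ : Type*} (p : MvPolynomial σ k) : Prop :=
  ∃ a b : σ →₀ ℕ, a ≠ b ∧ ∃ u v : k, (u = 1 ∨ u = -1) ∧ (v = 1 ∨ v = -1) ∧
    p = monomial a u + monomial b v

/-- The set of the `t × t` minors of `M` that are binomials. -/
def binomialMinors {k : Type*} [Field k] {σ ι κ : Type*} (M : Matrix ι κ (MvPolynomial σ k))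
    (t : ℕ) : Set (MvPolynomial σ k) :=
  {p | IsBinomial p ∧ ∃ (f : Fin t ↪ ι) (g : Fin t ↪ κ), p = (M.submatrix f g).det}

theorem eq_of_edgeExponent_le {V : Type*} {G : SimpleGraph V} {s s' : Sym2 V}
    (hs : s ∈ G.edgeSet) (h : edgeExponent s ≤ edgeExponent s') : s = s' := by
  classical
  induction s with
  | _ a b =>
    induction s' with
    | _ c d =>
      have hab : a ≠ b := G.ne_of_adj hs
      have ha := h a
      have hb := h b
      simp only [edgeExponent, Sym2.lift_mk, Finsupp.add_apply, Finsupp.single_apply] at ha hb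
      rw [Sym2.eq_iff]
      grind

/-- A Jacobian dual of the Taylor presentation matrix of an edge ideal always exists. -/
theorem exists_isJacobianDual (k : Type*) [Field k] {V : Type*} [Fintype V] {G : SimpleGraph V}
    {r : ℕ} (e : Fin r ≃ G.edgeSet) : ∃ B, IsJacobianDual (edgeTaylorMatrix k e) B := by
  classical
  have key : ∀ j τ, ∃ c : V → MvPolynomial V k, ∑ v, c v * X v = edgeTaylorMatrix k e j τ := by
    intro j τ
    rw [← Ideal.mem_span_range_iff_exists_fun]
    have hm : j ∈ τ.1 → (monomial (τ.1.sup (fun i => edgeExponent (e i : Sym2 V)) -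
        edgeExponent (e j : Sym2 V)) (1 : k)) ∈ Ideal.span (Set.range (X : V → MvPolynomial V k)) := by
      intro hj
      obtain ⟨l, hl, hlj⟩ := Finset.exists_mem_ne (by rw [τ.2]; norm_num) j
      have hne : τ.1.sup (fun i => edgeExponent (e i : Sym2 V)) -
          edgeExponent (e j : Sym2 V) ≠ 0 := by
        intro h0
        have hle : edgeExponent (e l : Sym2 V) ≤ edgeExponent (e j : Sym2 V) :=
          (Finset.le_sup (f := fun i => edgeExponent (e i : Sym2 V)) hl).trans
            (tsub_eq_zero_iff_le.mp h0)
        exact hlj (e.injective (Subtype.ext (eq_of_edgeExponent_le (e l).2 hle)))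
      obtain ⟨v, hv⟩ := Finsupp.ne_iff.mp hne
      refine Ideal.mem_of_dvd _ (X_dvd_monomial.mpr (Or.inr hv))
        (Ideal.subset_span (Set.mem_range_self v))
    unfold edgeTaylorMatrix taylorPresentationMatrix
    simp only [Matrix.of_apply]
    split_ifs with h1 h2
    · exact neg_mem (hm h1)
    · exact hm h1
    · exact zero_mem _
  choose c hc using key
  refine ⟨Matrix.of fun v τ => ∑ j, C (c j τ v) * X j, ⟨fun v τ => ?_, ?_⟩⟩
  · rw [Matrix.of_apply]
    exact IsHomogeneous.sum _ _ _ fun j _ => by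
      simpa using (isHomogeneous_C (Fin r) (c j τ v)).mul (isHomogeneous_X _ j)
  · funext τ
    simp only [linearForms, Matrix.vecMul, dotProduct, Matrix.map_apply, Matrix.of_apply, ← hc,
      map_sum, map_mul, Finset.mul_sum]
    rw [Finset.sum_comm]
    refine Finset.sum_congr rfl fun v _ => Finset.sum_congr rfl fun j _ => by ring

end

/-! The map `T_i ↦ f_i t` sends monomials to monomials, so its kernel is spanned over `k` by the
differences `x^p T^α - x^q T^β` of monomials with equal image (`mem_of_monomialReesMap_eq_zero`).
For the inclusion of `J` in the proposed ideal, `biMonomial_sub_mem` treats these differences by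
induction on the degree of `α`, after cancelling the common part of `x^p` and `x^q`. If `p ≠ 0`,
some variable of `x^p` lies on an edge of `β`; a Taylor relation brings that edge into the first
term, where it cancels.

If `p = 0`, then `q = 0`, and `α`, `β` are multisets of edges with equal degree at every vertex.
Alternating edges of `α` and `β` gives a closed trail (`exists_isClosedTrail`), hence products
`T^A`, `T^B` dividing `T^α`, `T^β`. The edges `a l`, `b l` meet at `u l`, so in the reduced Jacobian
dual the column of `{a l, b l}` lives in the rows `p l` and `p (l + 1)`. Around the trail these
columns form a cyclic bidiagonal matrix of determinant `±(T^A - T^B)` (`det_cyclic_bidiagonal`).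
Only the rows `p l` must be distinct; the `u l` may repeat.

Conversely, each column of the reduced Jacobian dual is zero or has exactly two nonzero entries, and
the row `(x_v)` annihilates its image in `R[t]`. So each minor vanishes in `R[t]` or is a signed
monomial (`det_submatrix_eq_zero_or_isSignedMonomial`), and a binomial is not a signed monomial. -/

/-! ### Exponent vectors of edges and monomials in both sets of variables -/

open Finsupp in
theorem edgeExponent_eq_of_apply_ne_zero {V : Type*} {G : SimpleGraph V} {s : Sym2 V}
    (hs : s ∈ G.edgeSet) {v : V} (h : edgeExponent s v ≠ 0) :
    ∃ u, u ≠ v ∧ edgeExponent s = single v 1 + single u 1 := by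
  classical
  induction s with
  | _ a b =>
    have hab : a ≠ b := G.ne_of_adj hs
    simp only [edgeExponent, Sym2.lift_mk, Finsupp.add_apply, Finsupp.single_apply] at h ⊢
    by_cases ha : a = v
    · subst ha
      exact ⟨b, hab.symm, rfl⟩
    · have hb : b = v := by
        by_contra hb
        simp [ha, hb] at h
      subst hb
      exact ⟨a, hab, add_comm _ _⟩

theorem degree_edgeExponent {V : Type*} (s : Sym2 V) : (edgeExponent s).degree = 2 := by
  induction s with
  | _ a b => simp [edgeExponent]

theorem edgeExponent_injective {V : Type*} {G : SimpleGraph V} {r : ℕ} (e : Fin r ≃ G.edgeSet) :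
    Function.Injective fun i => edgeExponent (e i : Sym2 V) := fun i _ h =>
  e.injective (Subtype.ext (eq_of_edgeExponent_le (e i).2 h.le))

/-- The monomial `x ^ p T ^ α` of `R[T_1, …, T_r]`. -/
noncomputable def biMonomial (k : Type*) [Field k] {V : Type*} {r : ℕ} (α : Fin r →₀ ℕ)
    (p : V →₀ ℕ) : MvPolynomial (Fin r) (MvPolynomial V k) :=
  monomial α (monomial p 1)

theorem biMonomial_mul (k : Type*) [Field k] {V : Type*} {r : ℕ} (α β : Fin r →₀ ℕ)
    (p q : V →₀ ℕ) : biMonomial k α p * biMonomial k β q = biMonomial k (α + β) (p + q) := by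
  simp [biMonomial, monomial_mul]

/-! ### Taylor relations and the columns of the reduced Jacobian dual -/

theorem X_mul_C_neg {A σ : Type*} [CommRing A] (i : σ) (a : A) :
    (X i : MvPolynomial σ A) * C (-a) = -(X i * C a) := by
  rw [map_neg, mul_neg]

theorem linearForms_taylorPresentationMatrix (k : Type*) [Field k] {V : Type*} {r : ℕ}
    (m : Fin r → V →₀ ℕ) {i j : Fin r} (hij : i < j)
    (τ : {τ : Finset (Fin r) // τ.card = 2}) (hτ : τ.1 = {i, j}) :
    linearForms (taylorPresentationMatrix k m) τ =
      biMonomial k (Finsupp.single j 1) (m i ⊔ m j - m j) -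
        biMonomial k (Finsupp.single i 1) (m i ⊔ m j - m i) := by
  have hsup : τ.1.sup m = m i ⊔ m j := by rw [hτ]; simp
  have hz : ∀ l ∉ τ.1, (X l : MvPolynomial (Fin r) (MvPolynomial V k)) *
      C (taylorPresentationMatrix k m l τ) = 0 := by
    intro l hl
    simp [taylorPresentationMatrix, hl]
  simp only [linearForms, Matrix.vecMul, dotProduct, Matrix.map_apply]
  rw [← Finset.sum_subset (Finset.subset_univ τ.1) (fun l _ hl => hz l hl), hτ,
    Finset.sum_pair hij.ne]
  simp only [taylorPresentationMatrix, Matrix.of_apply, hsup]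
  have h1 : i ∈ τ.1 := by simp [hτ]
  have h2 : j ∈ τ.1 := by simp [hτ]
  have h3 : ∃ l ∈ τ.1, i < l := ⟨j, h2, hij⟩
  have h4 : ¬ ∃ l ∈ τ.1, j < l := by
    rw [hτ]
    simp [hij.le]
  rw [if_pos h1, if_pos h2, if_pos h3, if_neg h4]
  have hmul : ∀ (l : Fin r) (q : V →₀ ℕ),
      (X l : MvPolynomial (Fin r) (MvPolynomial V k)) * C (monomial q 1) =
        biMonomial k (Finsupp.single l 1) q := fun l q => by
    rw [biMonomial, X, mul_comm, C_mul_monomial, mul_one]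
  rw [X_mul_C_neg, hmul, hmul]
  ring

theorem linearForms_taylorPresentationMatrix_of_ne (k : Type*) [Field k] {V : Type*} {r : ℕ}
    (m : Fin r → V →₀ ℕ) {i j : Fin r} (hij : i ≠ j)
    (τ : {τ : Finset (Fin r) // τ.card = 2}) (hτ : τ.1 = {i, j}) :
    ∃ s : k, (s = 1 ∨ s = -1) ∧ linearForms (taylorPresentationMatrix k m) τ =
      C (C s) * (biMonomial k (Finsupp.single i 1) (m i ⊔ m j - m i) -
        biMonomial k (Finsupp.single j 1) (m i ⊔ m j - m j)) := by
  rcases hij.lt_or_gt with h | h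
  · refine ⟨-1, Or.inr rfl, ?_⟩
    rw [linearForms_taylorPresentationMatrix k m h τ hτ]
    simp only [map_neg, map_one]
    ring
  · refine ⟨1, Or.inl rfl, ?_⟩
    rw [linearForms_taylorPresentationMatrix k m h τ (hτ.trans (Finset.pair_comm _ _))]
    simp [sup_comm]

theorem exists_eq_pair {r : ℕ} (τ : {τ : Finset (Fin r) // τ.card = 2}) :
    ∃ i j, i ≠ j ∧ τ.1 = {i, j} :=
  Finset.card_eq_two.mp τ.2

/-- Reduction keeps the constant terms of the coefficients of `B v c`, and in `∑ x_w B w c` exactly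
these contribute to `x_v`. Hence the reduced matrix depends on `φ` alone, not on the choice of `B`.
-/
theorem coeff_reducedMatrix {k : Type*} [Field k] {V : Type*} [Fintype V] {r : ℕ} {κ : Type*}
    {φ : Matrix (Fin r) κ (MvPolynomial V k)}
    {B : Matrix V κ (MvPolynomial (Fin r) (MvPolynomial V k))} (hB : IsJacobianDual φ B)
    (v : V) (c : κ) (γ : Fin r →₀ ℕ) :
    coeff γ (reducedMatrix B v c) =
      coeff (Finsupp.single v 1) (coeff γ (linearForms φ c)) := by
  classical
  rw [hB.eq]
  simp only [Matrix.vecMul, dotProduct, coeff_sum, coeff_C_mul, reducedMatrix, Matrix.map_apply,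
    coeff_map]
  rw [Finset.sum_eq_single v]
  · rw [← add_zero (Finsupp.single v 1), coeff_X_mul]
    rfl
  · intro w _ hw
    rw [coeff_X_mul', if_neg]
    simpa using hw
  · simp

/-- The column of the reduced Jacobian dual of a Taylor matrix at `{i, j}`. -/
theorem reducedMatrix_pair {k : Type*} [Field k] {V : Type*} [Fintype V] [DecidableEq V] {r : ℕ}
    {m : Fin r → V →₀ ℕ}
    {B : Matrix V {τ : Finset (Fin r) // τ.card = 2} (MvPolynomial (Fin r) (MvPolynomial V k))}
    (hB : IsJacobianDual (taylorPresentationMatrix k m) B) {i j : Fin r} (hij : i ≠ j)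
    (τ : {τ : Finset (Fin r) // τ.card = 2}) (hτ : τ.1 = {i, j}) :
    ∃ s : k, (s = 1 ∨ s = -1) ∧ ∀ v, reducedMatrix B v τ =
      (if m i ⊔ m j - m i = Finsupp.single v 1 then monomial (Finsupp.single i 1) s else 0) -
      (if m i ⊔ m j - m j = Finsupp.single v 1 then monomial (Finsupp.single j 1) s else 0) := by
  obtain ⟨s, hs, h⟩ := linearForms_taylorPresentationMatrix_of_ne k m hij τ hτ
  refine ⟨s, hs, fun v => ?_⟩
  ext γ
  rw [coeff_reducedMatrix hB, h]
  simp only [coeff_C_mul, coeff_sub, biMonomial, coeff_monomial]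
  split_ifs <;> simp_all [coeff_monomial]

/-! ### Minors: rank, cyclic determinants, signed monomials -/

theorem le_rank_of_det_submatrix_ne_zero {A : Type*} [CommRing A] [IsDomain A] {ι κ : Type*}
    [Fintype κ] [Finite ι] {t : ℕ} (M : Matrix ι κ A) (f : Fin t → ι) (g : Fin t → κ)
    (h : (M.submatrix f g).det ≠ 0) : t ≤ M.rank := by
  classical
  have hli : LinearIndependent A (M.submatrix f g).col :=
    Matrix.linearIndependent_cols_of_det_ne_zero h
  have hli2 : LinearIndependent A (fun c => M.col (g c)) := by
    refine LinearIndependent.of_comp (LinearMap.funLeft A A f) ?_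
    exact hli
  have hmem : ∀ c, M.col (g c) ∈ LinearMap.range M.mulVecLin := fun c =>
    ⟨Pi.single (g c) 1, by ext; simp⟩
  have hli3 : LinearIndependent A
      (fun c => (⟨M.col (g c), hmem c⟩ : LinearMap.range M.mulVecLin)) :=
    LinearIndependent.of_comp (LinearMap.range M.mulVecLin).subtype hli2
  simpa [Matrix.rank] using hli3.fintype_card_le_finrank

open scoped Fin.CommRing in
/-- The determinant of a cyclic bidiagonal matrix. -/
theorem det_cyclic_bidiagonal {A : Type*} [CommRing A] {n : ℕ} (b a : Fin (n + 2) → A)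
    (N : Matrix (Fin (n + 2)) (Fin (n + 2)) A) (h0 : ∀ c, N c c = b c)
    (h1 : ∀ c, N (c + 1) c = - a c) (h2 : ∀ i c, i ≠ c → i ≠ c + 1 → N i c = 0) :
    N.det = ∏ c, b c - ∏ c, a c := by
  classical
  rw [Matrix.det_apply]
  have hne : (1 : Equiv.Perm (Fin (n + 2))) ≠ finRotate (n + 2) := by
    intro h
    have := congrArg (fun σ : Equiv.Perm _ => σ 0) h
    simp at this
  rw [← Finset.sum_subset (Finset.subset_univ {1, finRotate (n + 2)}), Finset.sum_pair hne]
  · simp only [Equiv.Perm.sign_one, Equiv.Perm.coe_one, id_eq, h0, one_smul, sign_finRotate,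
      finRotate_apply, h1, Finset.prod_neg, Finset.card_univ, Fintype.card_fin]
    rw [Units.smul_def, zsmul_eq_mul]
    push_cast
    rw [← mul_assoc, ← pow_add, Odd.neg_one_pow ⟨n + 1, by omega⟩]
    ring
  · intro σ _ hσ
    by_contra hprod
    have hnz : ∀ c, N (σ c) c ≠ 0 := by
      intro c hc
      apply hprod
      rw [Finset.prod_eq_zero (f := fun i => N (σ i) i) (Finset.mem_univ c) hc, smul_zero]
    have hor : ∀ c, σ c = c ∨ σ c = c + 1 := by
      intro c
      by_contra hc
      push Not at hc
      exact hnz c (h2 _ _ hc.1 hc.2)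
    have hne1 : σ ≠ 1 := fun h => hσ (by simp [h])
    obtain ⟨c₀, hc₀⟩ : ∃ c, σ c ≠ c := by
      by_contra hc
      push Not at hc
      exact hne1 (Equiv.ext hc)
    -- Once `σ` sends an index to its successor, injectivity forbids it to fix that successor, so
    -- the shift propagates around the whole cycle.
    have hstep : ∀ l : ℕ, σ (c₀ + (l : Fin (n + 2))) = c₀ + (l : Fin (n + 2)) + 1 := by
      intro l
      induction l with
      | zero => simpa using (hor c₀).resolve_left hc₀
      | succ l ih =>
        refine (hor _).resolve_left fun h => ?_
        rw [Nat.cast_succ, ← add_assoc, ← ih] at h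
        have := σ.injective h
        rw [ih] at this
        simp at this
    apply hσ
    have : σ = finRotate (n + 2) := by
      ext1 c
      have := hstep ((c - c₀ : Fin (n + 2)) : ℕ)
      simpa using this
    simp [this]

/-- A monomial with coefficient `1` or `-1`. -/
def IsSignedMonomial {k : Type*} [Field k] {σ : Type*} (p : MvPolynomial σ k) : Prop :=
  ∃ (γ : σ →₀ ℕ) (u : k), (u = 1 ∨ u = -1) ∧ p = monomial γ u

theorem IsSignedMonomial.mul {k : Type*} [Field k] {σ : Type*} {p q : MvPolynomial σ k}
    (hp : IsSignedMonomial p) (hq : IsSignedMonomial q) : IsSignedMonomial (p * q) := by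
  obtain ⟨γ, u, hu, rfl⟩ := hp
  obtain ⟨δ, v, hv, rfl⟩ := hq
  refine ⟨γ + δ, u * v, ?_, monomial_mul⟩
  rcases hu with rfl | rfl <;> rcases hv with rfl | rfl <;> simp

theorem isSignedMonomial_neg_one_pow (k : Type*) [Field k] (σ : Type*) (n : ℕ) :
    IsSignedMonomial ((-1) ^ n : MvPolynomial σ k) :=
  ⟨0, (-1) ^ n, neg_one_pow_eq_or k n, by simp [monomial_zero']⟩

theorem IsBinomial.not_isSignedMonomial {k : Type*} [Field k] {σ : Type*} {p : MvPolynomial σ k}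
    (h : IsBinomial p) : ¬ IsSignedMonomial p := by
  classical
  rintro ⟨γ, w, -, hp⟩
  obtain ⟨a, b, hab, u, v, hu, hv, rfl⟩ := h
  have hu0 : u ≠ 0 := by rcases hu with rfl | rfl <;> simp
  have hv0 : v ≠ 0 := by rcases hv with rfl | rfl <;> simp
  have ha := congrArg (coeff a) hp
  have hb := congrArg (coeff b) hp
  simp only [coeff_add, coeff_monomial, if_neg hab, if_neg hab.symm, if_true, add_zero,
    zero_add] at ha hb
  have h1 : γ = a := by
    by_contra h
    exact hu0 (ha.trans (if_neg h))
  have h2 : γ = b := by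
    by_contra h
    exact hv0 (hb.trans (if_neg h))
  exact hab (h1.symm.trans h2)

theorem det_eq_of_column_eq_zero {A : Type*} [CommRing A] {t : ℕ}
    (N : Matrix (Fin (t + 1)) (Fin (t + 1)) A) (i₀ c : Fin (t + 1))
    (h : ∀ i, i ≠ i₀ → N i c = 0) :
    N.det = (-1) ^ (i₀ + c : ℕ) * N i₀ c * (N.submatrix i₀.succAbove c.succAbove).det := by
  rw [Matrix.det_succ_column N c, Finset.sum_eq_single i₀]
  · intro i _ hi
    simp [h i hi]
  · simp

/-- If every nonzero column of `M` consists of two signed monomials that are made opposite by the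
weights `y` under `ψ`, then each minor of `M` is killed by `ψ` or is a signed monomial. -/
theorem det_submatrix_eq_zero_or_isSignedMonomial {k : Type*} [Field k] {σ ι κ D : Type*}
    [CommRing D] [IsDomain D] (ψ : MvPolynomial σ k →+* D) (y : ι → D) (hy : ∀ v, y v ≠ 0)
    (M : Matrix ι κ (MvPolynomial σ k))
    (hM : ∀ c, (∀ v, M v c = 0) ∨ ∃ a b, a ≠ b ∧ (∀ v, v ≠ a → v ≠ b → M v c = 0) ∧
      IsSignedMonomial (M a c) ∧ IsSignedMonomial (M b c) ∧
        y a * ψ (M a c) + y b * ψ (M b c) = 0)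
    (t : ℕ) (f : Fin t → ι) (hf : Function.Injective f) (g : Fin t → κ) :
    ψ (M.submatrix f g).det = 0 ∨ IsSignedMonomial (M.submatrix f g).det := by
  classical
  induction t with
  | zero =>
    right
    simpa using isSignedMonomial_neg_one_pow k σ 0
  | succ t ih =>
    -- A column with at most one nonzero entry in the chosen rows allows Laplace expansion and
    -- induction. Otherwise every chosen column keeps both of its entries.
    by_cases hc : ∃ c i₀, (∀ i, i ≠ i₀ → M (f i) (g c) = 0) ∧
        (M (f i₀) (g c) = 0 ∨ IsSignedMonomial (M (f i₀) (g c)))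
    · obtain ⟨c, i₀, h0, h1⟩ := hc
      rw [det_eq_of_column_eq_zero (M.submatrix f g) i₀ c h0, Matrix.submatrix_submatrix]
      rcases ih (f ∘ i₀.succAbove) (hf.comp Fin.succAbove_right_injective)
        (g ∘ c.succAbove) with h | h
      · left
        rw [map_mul, h, mul_zero]
      · rcases h1 with h1 | h1
        · left
          simp [h1]
        · right
          exact ((isSignedMonomial_neg_one_pow k σ _).mul h1).mul h
    · left
      push Not at hc
      -- With both entries present in every column, the weights form a nonzero left kernel vector of
      -- the image matrix.
      have hvec : Matrix.vecMul (fun i => y (f i)) (ψ.mapMatrix (M.submatrix f g)) = 0 := by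
        funext c
        simp only [Matrix.vecMul, dotProduct, RingHom.mapMatrix_apply, Matrix.map_apply,
          Matrix.submatrix_apply, Pi.zero_apply]
        rcases hM (g c) with h | ⟨a, b, hab, h0, ha, hb, hrel⟩
        · simp [h]
        · have hra : ∃ i, f i = a := by
            by_contra hna
            push Not at hna
            by_cases hnb : ∃ i, f i = b
            · obtain ⟨i, rfl⟩ := hnb
              exact (hc c i fun j hj => h0 _ (hna j) (hf.ne hj)).2 hb
            · push Not at hnb
              exact (hc c 0 fun j _ => h0 _ (hna j) (hnb j)).1 (h0 _ (hna 0) (hnb 0))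
          obtain ⟨i, rfl⟩ := hra
          have hrb : ∃ i, f i = b := by
            by_contra hnb
            push Not at hnb
            exact (hc c i fun j hj => h0 _ (hf.ne hj) (hnb j)).2 ha
          obtain ⟨j, rfl⟩ := hrb
          have hij : i ≠ j := fun h => hab (congrArg f h)
          rw [← Finset.sum_subset (Finset.subset_univ {i, j}), Finset.sum_pair hij, hrel]
          intro l _ hl
          simp only [Finset.mem_insert, Finset.mem_singleton, not_or] at hl
          rw [h0 _ (hf.ne hl.1) (hf.ne hl.2), map_zero, mul_zero]
      rw [RingHom.map_det]
      exact Matrix.exists_vecMul_eq_zero_iff.mp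
        ⟨_, fun h => hy (f 0) (congrFun h 0), hvec⟩

/-! ### Exchange of two generators, and alternating closed trails -/

/-- The common value `s + m i` is divisible by the lcm of the two generators, so the difference is a
monomial multiple of their Taylor relation. -/
theorem monomial_sub_mem_of_add_eq_add (k : Type*) [Field k] {V : Type*} {r : ℕ}
    (m : Fin r → V →₀ ℕ) (K : Ideal (MvPolynomial (Fin r) (MvPolynomial V k)))
    (hK : ∀ i j, biMonomial k (Finsupp.single i 1) (m i ⊔ m j - m i) -
      biMonomial k (Finsupp.single j 1) (m i ⊔ m j - m j) ∈ K)
    {i j : Fin r} {s s' : V →₀ ℕ} (h : s + m i = s' + m j) :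
    biMonomial k (Finsupp.single i 1) s - biMonomial k (Finsupp.single j 1) s' ∈ K := by
  have hle : m i ⊔ m j ≤ s + m i := sup_le le_add_self (h ▸ le_add_self)
  have h1 : s = (s + m i - m i ⊔ m j) + (m i ⊔ m j - m i) := by
    ext v
    have := hle v
    simp at this ⊢
    omega
  have h2 : s' = (s + m i - m i ⊔ m j) + (m i ⊔ m j - m j) := by
    ext v
    have := hle v
    have := DFunLike.congr_fun h v
    simp at *
    omega
  have := K.mul_mem_left (biMonomial k 0 (s + m i - m i ⊔ m j)) (hK i j)
  rwa [mul_sub, biMonomial_mul, biMonomial_mul, zero_add, zero_add, ← h1, ← h2] at this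

/-- A closed walk `p 0, u 0, p 1, u 1, …, p t = p 0` whose vertices `p 0, …, p (t - 1)` are
distinct, with the edges `p l, u l` numbered `a l` and the edges `u l, p (l + 1)` numbered
`b l`. -/
structure IsClosedTrail {V : Type*} {r : ℕ} (m : Fin r → V →₀ ℕ) (t : ℕ) (p u : ℕ → V)
    (a b : ℕ → Fin r) : Prop where
  pos : 0 < t
  inj : Set.InjOn p (Set.Iio t)
  closed : p t = p 0
  left : ∀ l < t, m (a l) = Finsupp.single (p l) 1 + Finsupp.single (u l) 1
  right : ∀ l < t, m (b l) = Finsupp.single (u l) 1 + Finsupp.single (p (l + 1)) 1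

theorem exists_apply_ne_zero_of_linearCombination {V : Type*} {r : ℕ} (m : Fin r → V →₀ ℕ)
    {α : Fin r →₀ ℕ} {v : V} (h : Finsupp.linearCombination ℕ m α v ≠ 0) :
    ∃ i, Finsupp.single i 1 ≤ α ∧ m i v ≠ 0 := by
  rw [Finsupp.linearCombination_apply, Finsupp.sum, Finsupp.finsetSum_apply] at h
  obtain ⟨i, -, hi⟩ := Finset.exists_ne_zero_of_sum_ne_zero h
  simp only [Finsupp.smul_apply, smul_eq_mul] at hi
  have := mul_ne_zero_iff.mp hi
  exact ⟨i, Finsupp.single_le_iff.mpr (Nat.one_le_iff_ne_zero.mpr this.1), this.2⟩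

/-- The contributions of the `u l` and of the interior `p l` cancel, which leaves the two endpoints.
-/
theorem linearCombination_trail {V : Type*} {r : ℕ} (m : Fin r → V →₀ ℕ) (p u : ℕ → V)
    (a b : ℕ → Fin r) (n : ℕ)
    (hl : ∀ l < n, m (a l) = Finsupp.single (p l) 1 + Finsupp.single (u l) 1)
    (hr : ∀ l < n, m (b l) = Finsupp.single (u l) 1 + Finsupp.single (p (l + 1)) 1) :
    Finsupp.linearCombination ℕ m (∑ l ∈ Finset.range n, Finsupp.single (a l) 1) +
        Finsupp.single (p n) 1 =
      Finsupp.linearCombination ℕ m (∑ l ∈ Finset.range n, Finsupp.single (b l) 1) +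
        Finsupp.single (p 0) 1 := by
  induction n with
  | zero => simp
  | succ n ih =>
    have := ih (fun l h => hl l (by omega)) (fun l h => hr l (by omega))
    rw [Finset.sum_range_succ, Finset.sum_range_succ, map_add, map_add,
      Finsupp.linearCombination_single, Finsupp.linearCombination_single, one_smul, one_smul,
      hl n (by omega), hr n (by omega)]
    ext v
    have := DFunLike.congr_fun this v
    simp only [Finsupp.add_apply] at this ⊢
    omega

/-- A trail is grown greedily, with edges taken in turn from `α` and `β`. Equality of vertex degrees
always supplies an unused edge at the current end, and finiteness of `V` forces a repeated `p`. The
bounds on the sums ensure that edges are used with at most their multiplicity. -/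
theorem exists_isClosedTrail {V : Type*} [Fintype V] {r : ℕ} (m : Fin r → V →₀ ℕ)
    (hm : ∀ i v, m i v ≠ 0 → ∃ u, u ≠ v ∧ m i = Finsupp.single v 1 + Finsupp.single u 1)
    (hm0 : ∀ i, m i ≠ 0) {α β : Fin r →₀ ℕ} (hα : α ≠ 0)
    (h : Finsupp.linearCombination ℕ m α = Finsupp.linearCombination ℕ m β) :
    ∃ t p u a b, IsClosedTrail m t p u a b ∧
      ∑ l ∈ Finset.range t, Finsupp.single (a l) 1 ≤ α ∧
      ∑ l ∈ Finset.range t, Finsupp.single (b l) 1 ≤ β := by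
  classical
  by_contra hno
  -- If no trail ever closes, there are trails with arbitrarily many distinct vertices `p l`. They
  -- stop after an `α`-edge, so one more `a` is used than `b`.
  have key : ∀ n, ∃ (p u : ℕ → V) (a b : ℕ → Fin r), Set.InjOn p (Set.Iic n) ∧
      (∀ l ≤ n, m (a l) = Finsupp.single (p l) 1 + Finsupp.single (u l) 1) ∧
      (∀ l < n, m (b l) = Finsupp.single (u l) 1 + Finsupp.single (p (l + 1)) 1) ∧
      ∑ l ∈ Finset.range (n + 1), Finsupp.single (a l) 1 ≤ α ∧
      ∑ l ∈ Finset.range n, Finsupp.single (b l) 1 ≤ β := by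
    intro n
    induction n with
    | zero =>
      obtain ⟨i, hi⟩ := Finsupp.ne_iff.mp hα
      obtain ⟨v, hv⟩ := Finsupp.ne_iff.mp (hm0 i)
      obtain ⟨w, -, hw⟩ := hm i v hv
      refine ⟨fun _ => v, fun _ => w, fun _ => i, fun _ => i, ?_, fun _ _ => hw, by simp, ?_,
        by simp⟩
      · intro x hx y hy _
        simp at hx hy
        omega
      · simpa using Nat.one_le_iff_ne_zero.mpr hi
    | succ n ih =>
      obtain ⟨p, u, a, b, hinj, hl, hr, hA, hB⟩ := ih
      obtain ⟨α', hα'⟩ := exists_add_of_le hA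
      obtain ⟨β', hβ'⟩ := exists_add_of_le hB
      have tele := linearCombination_trail m p u a b n (fun l h => hl l h.le) hr
      -- The unused part of `β` exceeds the unused part of `α` by the two ends `p 0` and `u n`, so
      -- it has an edge at `u n`.
      have hbal : Finsupp.linearCombination ℕ m β' = Finsupp.linearCombination ℕ m α' +
          Finsupp.single (p 0) 1 + Finsupp.single (u n) 1 := by
        rw [hα', hβ', map_add, map_add, Finset.sum_range_succ, map_add,
          Finsupp.linearCombination_single, one_smul, hl n le_rfl] at h
        ext v
        have h1 := DFunLike.congr_fun tele v
        have h2 := DFunLike.congr_fun h v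
        simp only [Finsupp.add_apply] at h1 h2 ⊢
        omega
      obtain ⟨j, hj, hju⟩ := exists_apply_ne_zero_of_linearCombination m
        (α := β') (v := u n) (by rw [hbal]; simp)
      obtain ⟨w, -, hw⟩ := hm j _ hju
      set p' : ℕ → V := fun l => if l ≤ n then p l else w with hp'
      set b' : ℕ → Fin r := fun l => if l < n then b l else j with hb'
      have hp'n : p' (n + 1) = w := by simp [hp']
      have hp'l : ∀ l ≤ n, p' l = p l := fun l hl => by simp [hp', hl]
      have hl' : ∀ l ≤ n, m (a l) = Finsupp.single (p' l) 1 + Finsupp.single (u l) 1 :=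
        fun l h => by rw [hp'l l h, hl l h]
      have hr' : ∀ l < n + 1,
          m (b' l) = Finsupp.single (u l) 1 + Finsupp.single (p' (l + 1)) 1 := by
        intro l hln
        rcases Nat.lt_succ_iff_lt_or_eq.mp hln with h | rfl
        · rw [hp'l _ h, ← hr l h]
          simp [hb', h]
        · rw [hp'n, ← hw]
          simp [hb']
      have hB' : ∑ l ∈ Finset.range (n + 1), Finsupp.single (b' l) 1 ≤ β := by
        have h1 : ∑ l ∈ Finset.range n, Finsupp.single (b' l) 1 =
            ∑ l ∈ Finset.range n, Finsupp.single (b l) 1 :=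
          Finset.sum_congr rfl fun l hl => by simp [hb', Finset.mem_range.mp hl]
        rw [Finset.sum_range_succ, h1, hβ']
        refine add_le_add le_rfl ?_
        simpa [hb'] using hj
      -- If the new vertex `w` equals an earlier `p i`, the piece from index `i` on is a closed
      -- trail; the initial segment is discarded.
      by_cases hcl : ∃ i ≤ n, p i = w
      · exfalso
        obtain ⟨i, hin, hi⟩ := hcl
        have hsub : ∀ c : ℕ → Fin r, ∑ l ∈ Finset.range (n + 1 - i),
            Finsupp.single (c (i + l)) 1 ≤
              ∑ l ∈ Finset.range (n + 1), Finsupp.single (c l) 1 := by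
          intro c
          rw [← Finset.sum_Ico_eq_sum_range (fun l => Finsupp.single (c l) 1)]
          refine Finset.sum_le_sum_of_subset ?_
          intro l hl
          simp at hl ⊢
          exact hl.2
        refine hno ⟨n + 1 - i, fun l => p' (i + l), fun l => u (i + l), fun l => a (i + l),
          fun l => b' (i + l), ⟨by omega, ?_, ?_, ?_, ?_⟩, (hsub a).trans hA,
          (hsub b').trans hB'⟩
        · intro x hx y hy hxy
          simp only [Set.mem_Iio] at hx hy
          simp only [hp'l _ (show i + x ≤ n by omega), hp'l _ (show i + y ≤ n by omega)] at hxy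
          have := hinj (show i + x ≤ n by omega) (show i + y ≤ n by omega) hxy
          omega
        · simp only [show i + (n + 1 - i) = n + 1 by omega, add_zero, hp'n, hp'l _ hin, hi]
        · intro l hl
          exact hl' _ (by omega)
        · intro l hl
          exact hr' _ (by omega)
      · push Not at hcl
        have tele' := linearCombination_trail m p' u a b' (n + 1)
          (fun l h => hl' l (by omega)) hr'
        obtain ⟨β₁, hβ₁⟩ := exists_add_of_le hB'
        -- Since `w ≠ p 0`, the trail has one more `β`-edge than `α`-edges at `w`, counted with
        -- multiplicity, so an unused `α`-edge remains there.
        have hne : Finsupp.linearCombination ℕ m α' w ≠ 0 := by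
          rw [hα', hβ₁, map_add, map_add] at h
          have h1 := DFunLike.congr_fun tele' w
          have h2 := DFunLike.congr_fun h w
          rw [hp'n, hp'l 0 (by omega)] at h1
          simp only [Finsupp.add_apply, Finsupp.single_eq_same,
            Finsupp.single_eq_of_ne (hcl 0 (by omega)).symm] at h1 h2
          omega
        obtain ⟨j', hj', hj'w⟩ := exists_apply_ne_zero_of_linearCombination m hne
        obtain ⟨x, -, hx⟩ := hm j' _ hj'w
        refine ⟨p', fun l => if l ≤ n then u l else x, fun l => if l ≤ n then a l else j', b',
          ?_, ?_, ?_, ?_, hB'⟩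
        · intro y hy z hz hyz
          simp only [Set.mem_Iic] at hy hz
          rcases Nat.le_succ_iff.mp hy with hy | rfl <;> rcases Nat.le_succ_iff.mp hz with hz | rfl
          · rw [hp'l _ hy, hp'l _ hz] at hyz
            exact hinj hy hz hyz
          · rw [hp'l _ hy, hp'n] at hyz
            exact absurd hyz (hcl _ hy)
          · rw [hp'l _ hz, hp'n] at hyz
            exact absurd hyz.symm (hcl _ hz)
          · rfl
        · intro l hln
          rcases Nat.le_succ_iff.mp hln with h | rfl
          · simp only [h, if_true]
            exact hl' l h
          · simp only [hp'n, show ¬ n + 1 ≤ n by omega, if_false]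
            exact hx
        · intro l hln
          simp only [show l ≤ n by omega, if_true]
          exact hr' l hln
        · have h1 : ∑ l ∈ Finset.range (n + 1), Finsupp.single (if l ≤ n then a l else j') 1 =
              ∑ l ∈ Finset.range (n + 1), Finsupp.single (a l) 1 :=
            Finset.sum_congr rfl fun l hl => by
              rw [if_pos (Nat.lt_succ_iff.mp (Finset.mem_range.mp hl))]
          rw [Finset.sum_range_succ, h1, hα']
          refine add_le_add le_rfl ?_
          simpa using hj'
  obtain ⟨p, -, -, -, hinj, -⟩ := key (Fintype.card V)
  have := Finset.card_le_card_of_injOn (s := Finset.range (Fintype.card V + 1))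
    (t := Finset.univ) p (by simp) (hinj.mono fun x hx => by
      simp at hx
      simp
      omega)
  simp at this

/-! ### The minor attached to a closed trail -/

theorem pair_sup_sub_left {V : Type*} {x y u : V} (h : x ≠ y) :
    (Finsupp.single x 1 + Finsupp.single u 1) ⊔ (Finsupp.single u 1 + Finsupp.single y 1) -
      (Finsupp.single x 1 + Finsupp.single u 1) = (Finsupp.single y 1 : V →₀ ℕ) := by
  classical
  ext v
  simp only [Finsupp.tsub_apply, Finsupp.sup_apply, Finsupp.add_apply, Finsupp.single_apply]
  by_cases hx : x = v <;> by_cases hy : y = v <;> by_cases hu : u = v <;> simp_all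

theorem pair_sup_sub_right {V : Type*} {x y u : V} (h : x ≠ y) :
    (Finsupp.single x 1 + Finsupp.single u 1) ⊔ (Finsupp.single u 1 + Finsupp.single y 1) -
      (Finsupp.single u 1 + Finsupp.single y 1) = (Finsupp.single x 1 : V →₀ ℕ) := by
  classical
  ext v
  simp only [Finsupp.tsub_apply, Finsupp.sup_apply, Finsupp.add_apply, Finsupp.single_apply]
  by_cases hx : x = v <;> by_cases hy : y = v <;> by_cases hu : u = v <;> simp_all

theorem prod_neg_monomial {k σ ι : Type*} [Field k] [Fintype ι] (γ : ι → σ →₀ ℕ) (s : ι → k) :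
    ∏ c, -(monomial (γ c) (s c)) = monomial (∑ c, γ c) (∏ c, -(s c)) := by
  rw [monomial_sum_index, map_prod, ← Finset.prod_mul_distrib]
  refine Finset.prod_congr rfl fun c _ => ?_
  rw [C_mul_monomial, mul_one, map_neg]

theorem prod_neg_eq_one_or_neg_one {k ι : Type*} [Field k] [Fintype ι] (s : ι → k)
    (hs : ∀ c, s c = 1 ∨ s c = -1) : ∏ c, -(s c) = 1 ∨ ∏ c, -(s c) = -1 := by
  refine Finset.prod_induction (fun c => -(s c)) (fun x => x = 1 ∨ x = -1) ?_ (Or.inl rfl) ?_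
  · rintro a b (rfl | rfl) (rfl | rfl) <;> simp
  · intro c _
    rcases hs c with h | h <;> simp [h]

/-- The rows `p l` and columns `{a l, b l}` give a cyclic bidiagonal minor equal to the difference
up to sign. If it is nonzero, it is a binomial and its size is at most the rank, so it is among the
generators. -/
theorem IsClosedTrail.sub_mem {k : Type*} [Field k] {V : Type*} [Fintype V] {r : ℕ}
    {m : Fin r → V →₀ ℕ} (hm : Function.Injective m)
    {B : Matrix V {τ : Finset (Fin r) // τ.card = 2} (MvPolynomial (Fin r) (MvPolynomial V k))}
    (hB : IsJacobianDual (taylorPresentationMatrix k m) B)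
    (K : Ideal (MvPolynomial (Fin r) (MvPolynomial V k)))
    (hK : ∀ t ∈ Set.Icc 2 (reducedMatrix B).rank, ∀ q ∈ binomialMinors (reducedMatrix B) t,
      MvPolynomial.map C q ∈ K)
    {t : ℕ} {p u : ℕ → V} {a b : ℕ → Fin r} (h : IsClosedTrail m t p u a b) :
    biMonomial k (∑ l ∈ Finset.range t, Finsupp.single (a l) 1) 0 -
      biMonomial k (∑ l ∈ Finset.range t, Finsupp.single (b l) 1) 0 ∈ K := by
  classical
  obtain ⟨n, rfl | rfl⟩ : ∃ n, t = 1 ∨ t = n + 2 := ⟨t - 2, by have := h.pos; omega⟩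
  -- A closed trail of length one goes back along the same edge, so the difference is zero and no
  -- minor is needed.
  · have : m (a 0) = m (b 0) := by
      rw [h.left 0 one_pos, h.right 0 one_pos, zero_add, h.closed, add_comm]
    simp [hm this]
  have hnext : ∀ c : Fin (n + 2), p ((c : ℕ) + 1) = p ((c + 1 : Fin (n + 2)) : ℕ) := by
    intro c
    by_cases hc : c = Fin.last (n + 1)
    · subst hc
      simpa using h.closed
    · rw [Fin.val_add_one_of_lt (Fin.lt_last_iff_ne_last.mpr hc)]
  have hP : Function.Injective fun c : Fin (n + 2) => p c := fun x y hxy =>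
    Fin.ext (h.inj x.2 y.2 hxy)
  have hne : ∀ c : Fin (n + 2), p c ≠ p ((c : ℕ) + 1) := by
    intro c hc
    rw [hnext] at hc
    have := hP hc
    simp at this
  have hab : ∀ c : Fin (n + 2), a c ≠ b c := by
    intro c hc
    have := congrArg m hc
    rw [h.left c c.2, h.right c c.2, add_comm, add_right_inj] at this
    exact hne c (Finsupp.single_left_injective one_ne_zero this)
  let τ : Fin (n + 2) → {τ : Finset (Fin r) // τ.card = 2} := fun c =>
    ⟨{a c, b c}, Finset.card_pair (hab c)⟩
  choose s hs hcol using fun c : Fin (n + 2) => reducedMatrix_pair hB (hab c) (τ c) rfl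
  simp only [h.left _ (Fin.is_lt _), h.right _ (Fin.is_lt _), pair_sup_sub_left (hne _),
    pair_sup_sub_right (hne _), (Finsupp.single_left_injective one_ne_zero).eq_iff] at hcol
  have hdet : ((reducedMatrix B).submatrix (fun c : Fin (n + 2) => p c) τ).det =
      monomial (∑ l ∈ Finset.range (n + 2), Finsupp.single (b l) 1) (∏ c, -(s c)) -
        monomial (∑ l ∈ Finset.range (n + 2), Finsupp.single (a l) 1) (∏ c, -(s c)) := by
    rw [Finset.sum_range, Finset.sum_range, ← prod_neg_monomial, ← prod_neg_monomial]
    refine det_cyclic_bidiagonal _ _ _ ?_ ?_ ?_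
    · intro c
      rw [Matrix.submatrix_apply, hcol, if_neg (hne c).symm, if_pos rfl, zero_sub]
    · intro c
      rw [Matrix.submatrix_apply, hcol, if_pos (hnext c), if_neg, sub_zero, neg_neg]
      rw [← hnext]
      exact hne c
    · intro i c h1 h2
      rw [Matrix.submatrix_apply, hcol, if_neg, if_neg, sub_zero]
      · exact fun h => h1 (hP h).symm
      · rw [hnext]
        exact fun h => h2 (hP h).symm
  have hS := prod_neg_eq_one_or_neg_one s hs
  set S := ∏ c, -(s c)
  set α := ∑ l ∈ Finset.range (n + 2), Finsupp.single (a l) 1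
  set β := ∑ l ∈ Finset.range (n + 2), Finsupp.single (b l) 1
  by_cases hαβ : α = β
  · rw [hαβ, sub_self]
    exact K.zero_mem
  have hS0 : S ≠ 0 := by rcases hS with h | h <;> simp [h]
  have hdet0 : ((reducedMatrix B).submatrix (fun c : Fin (n + 2) => p c) τ).det ≠ 0 := by
    rw [hdet, sub_ne_zero]
    intro h
    rcases (monomial_eq_monomial_iff _ _ _ _).mp h with h | h
    · exact hαβ h.1.symm
    · exact hS0 h.1
  -- Repeated columns would make the determinant vanish.
  have hτ : Function.Injective τ := by
    intro x y hxy
    by_contra hne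
    exact hdet0 (Matrix.det_zero_of_column_eq hne fun i => by simp [hxy])
  have hbin : IsBinomial ((reducedMatrix B).submatrix (fun c : Fin (n + 2) => p c) τ).det := by
    refine ⟨β, α, Ne.symm hαβ, S, -S, hS, ?_, ?_⟩
    · rcases hS with h | h <;> simp [h]
    · rw [hdet, map_neg, sub_eq_add_neg]
  have hmem := hK (n + 2) ⟨by omega, le_rank_of_det_submatrix_ne_zero _ _ _ hdet0⟩ _
    ⟨hbin, ⟨_, hP⟩, ⟨τ, hτ⟩, rfl⟩
  rw [hdet] at hmem
  have heq : MvPolynomial.map (C : k →+* MvPolynomial V k) (monomial β S - monomial α S) =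
      C (C S) * (biMonomial k β 0 - biMonomial k α 0) := by
    simp [biMonomial, map_sub, map_monomial, mul_sub, C_mul_monomial, monomial_zero']
  rw [heq] at hmem
  have h2 := K.neg_mem (K.mul_mem_left (C (C S)) hmem)
  have hSS : S * S = 1 := by rcases hS with h | h <;> simp [h]
  rwa [← mul_assoc, ← map_mul, ← map_mul, hSS, map_one, map_one, one_mul, neg_sub] at h2

/-! ### Reduction of a binomial relation to Taylor relations and closed trails -/

theorem biMonomial_sub_mem {k : Type*} [Field k] {V : Type*} [Fintype V] {r : ℕ}
    {m : Fin r → V →₀ ℕ}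
    (hm : ∀ i v, m i v ≠ 0 → ∃ u, u ≠ v ∧ m i = Finsupp.single v 1 + Finsupp.single u 1)
    (hdeg : ∀ i, (m i).degree = 2)
    (K : Ideal (MvPolynomial (Fin r) (MvPolynomial V k)))
    (hT : ∀ i j, biMonomial k (Finsupp.single i 1) (m i ⊔ m j - m i) -
      biMonomial k (Finsupp.single j 1) (m i ⊔ m j - m j) ∈ K)
    (hC : ∀ t p u a b, IsClosedTrail m t p u a b →
      biMonomial k (∑ l ∈ Finset.range t, Finsupp.single (a l) 1) 0 -
        biMonomial k (∑ l ∈ Finset.range t, Finsupp.single (b l) 1) 0 ∈ K)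
    {α β : Fin r →₀ ℕ} {p q : V →₀ ℕ} (hαβ : α.degree = β.degree)
    (h : p + Finsupp.linearCombination ℕ m α = q + Finsupp.linearCombination ℕ m β) :
    biMonomial k α p - biMonomial k β q ∈ K := by
  classical
  have hlc : ∀ γ : Fin r →₀ ℕ, (Finsupp.linearCombination ℕ m γ).degree = 2 * γ.degree := by
    intro γ
    induction γ using Finsupp.induction_linear with
    | zero => simp
    | add f g hf hg => simp only [map_add, hf, hg, mul_add]
    | single i c => simp [hdeg, mul_comm]
  have hm0 : ∀ i, m i ≠ 0 := fun i hi => by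
    have := hdeg i
    simp [hi] at this
  induction hd : α.degree using Nat.strong_induction_on generalizing α β p q with
  | _ d ih =>
  wlog hpq : ∀ v, p v = 0 ∨ q v = 0 generalizing p q
  · have hp : p = p ⊓ q + (p - q) := by
      ext v
      simp
      omega
    have hq : q = p ⊓ q + (q - p) := by
      ext v
      simp
      omega
    have h' : p - q + Finsupp.linearCombination ℕ m α =
        q - p + Finsupp.linearCombination ℕ m β := by
      ext v
      have := DFunLike.congr_fun h v
      simp only [Finsupp.add_apply, Finsupp.tsub_apply] at this ⊢
      omega
    have h1 := K.mul_mem_left (biMonomial k 0 (p ⊓ q)) (this h' fun v => by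
      simp only [Finsupp.tsub_apply]
      omega)
    rwa [mul_sub, biMonomial_mul, biMonomial_mul, zero_add, zero_add, ← hp, ← hq] at h1
  by_cases hα : α = 0
  · subst hα
    have hβ : β = 0 := by
      rw [← Finsupp.degree_eq_zero_iff, ← hαβ]
      simp
    subst hβ
    simp only [map_zero, add_zero] at h
    simp [h]
  by_cases hp : p = 0
  -- Every generator has degree two and `α`, `β` have equal degree, so `p` and `q` have equal
  -- degree.
  · have hq : q = 0 := by
      have := congrArg Finsupp.degree h
      rw [map_add, map_add, hlc, hlc, hαβ, hp] at this
      rw [← Finsupp.degree_eq_zero_iff]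
      simpa using this
    subst hp hq
    rw [zero_add, zero_add] at h
    obtain ⟨t, x, u, a, b, htr, hA, hB⟩ := exists_isClosedTrail m hm hm0 hα h
    have hbase := hC t x u a b htr
    have hlcAB := linearCombination_trail m x u a b t htr.left htr.right
    rw [htr.closed, add_left_inj] at hlcAB
    have hdA : (∑ l ∈ Finset.range t, Finsupp.single (a l) 1).degree = t := by simp
    have hdB : (∑ l ∈ Finset.range t, Finsupp.single (b l) 1).degree = t := by simp
    set A := ∑ l ∈ Finset.range t, Finsupp.single (a l) 1
    set B := ∑ l ∈ Finset.range t, Finsupp.single (b l) 1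
    obtain ⟨α', rfl⟩ := exists_add_of_le hA
    obtain ⟨β', rfl⟩ := exists_add_of_le hB
    rw [map_add, map_add, hdA, hdB] at hαβ
    rw [map_add, hdA] at hd
    rw [map_add, map_add, hlcAB, add_right_inj] at h
    have hrec := ih α'.degree (by have := htr.pos; omega) (α := α') (β := β') (p := 0) (q := 0)
      (by omega) (by rw [h]) rfl
    have h1 := K.mul_mem_left (biMonomial k α' 0) hbase
    have h2 := K.mul_mem_left (biMonomial k B 0) hrec
    rw [mul_sub, biMonomial_mul, biMonomial_mul, add_zero] at h1 h2
    have := K.add_mem h1 h2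
    rwa [add_comm α' A, add_comm α' B, sub_add_sub_cancel] at this
  · obtain ⟨v, hv⟩ := Finsupp.ne_iff.mp hp
    rw [Finsupp.zero_apply] at hv
    have hqv := (hpq v).resolve_left hv
    obtain ⟨i, hiβ, hiv⟩ := exists_apply_ne_zero_of_linearCombination m (α := β) (v := v) (by
      have := DFunLike.congr_fun h v
      simp only [Finsupp.add_apply] at this
      omega)
    obtain ⟨u, huv, hu⟩ := hm i v hiv
    obtain ⟨β', rfl⟩ := exists_add_of_le hiβ
    -- The edge `i = {v, u}` must divide `x^p f_j`. The variable `x_v` comes from `x^p`. If `x_u`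
    -- does not divide `x^p`, take `j` in `α` through `u`; otherwise any `j` in `α` works.
    obtain ⟨j, hjα, hj⟩ : ∃ j, Finsupp.single j 1 ≤ α ∧ m i ≤ p + m j := by
      by_cases hpu : p u = 0
      · obtain ⟨j, hjα, hju⟩ := exists_apply_ne_zero_of_linearCombination m (α := α) (v := u) (by
          have := DFunLike.congr_fun h u
          rw [map_add, Finsupp.linearCombination_single, one_smul, hu] at this
          simp only [Finsupp.add_apply, Finsupp.single_eq_same] at this
          omega)
        refine ⟨j, hjα, fun w => ?_⟩
        rw [hu]
        simp only [Finsupp.add_apply, Finsupp.single_apply]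
        split_ifs <;> subst_vars <;> omega
      · obtain ⟨j, hj⟩ := Finsupp.ne_iff.mp hα
        refine ⟨j, Finsupp.single_le_iff.mpr (Nat.one_le_iff_ne_zero.mpr hj), fun w => ?_⟩
        rw [hu]
        simp only [Finsupp.add_apply, Finsupp.single_apply]
        split_ifs <;> subst_vars <;> first | omega | exact absurd rfl huv
    obtain ⟨α', rfl⟩ := exists_add_of_le hjα
    have hsw := monomial_sub_mem_of_add_eq_add k m K hT (i := j) (j := i) (s := p)
      (s' := p + m j - m i) (tsub_add_cancel_of_le hj).symm
    rw [map_add, Finsupp.degree_single] at hd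
    rw [map_add, map_add, Finsupp.degree_single, Finsupp.degree_single] at hαβ
    have hrec := ih α'.degree (by omega) (α := α') (β := β') (p := p + m j - m i) (q := q)
      (by omega) (by
        rw [map_add, map_add, Finsupp.linearCombination_single, Finsupp.linearCombination_single,
          one_smul, one_smul] at h
        ext w
        have h1 := DFunLike.congr_fun h w
        have h2 := hj w
        simp only [Finsupp.add_apply, Finsupp.tsub_apply] at h1 h2 ⊢
        omega) rfl
    have h1 := K.mul_mem_left (biMonomial k α' 0) hsw
    have h2 := K.mul_mem_left (biMonomial k (Finsupp.single i 1) 0) hrec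
    rw [mul_sub, biMonomial_mul, biMonomial_mul, zero_add, zero_add] at h1 h2
    have := K.add_mem h1 h2
    rwa [add_comm α', add_comm α', sub_add_sub_cancel] at this

/-! ### The Rees map on monomials and its kernel -/

/-- The map `R[T] → R[t]`, `T_i ↦ x ^ m_i t`, for monomials `x ^ m_i`. -/
noncomputable def monomialReesMap (k : Type*) [Field k] {V : Type*} {r : ℕ} (m : Fin r → V →₀ ℕ) :
    MvPolynomial (Fin r) (MvPolynomial V k) →ₐ[MvPolynomial V k] Polynomial (MvPolynomial V k) :=
  aeval fun i => Polynomial.monomial 1 (monomial (m i) 1)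

theorem monomialReesMap_biMonomial (k : Type*) [Field k] {V : Type*} {r : ℕ}
    (m : Fin r → V →₀ ℕ) (α : Fin r →₀ ℕ) (p : V →₀ ℕ) :
    monomialReesMap k m (biMonomial k α p) =
      Polynomial.monomial α.degree (monomial (p + Finsupp.linearCombination ℕ m α) 1) := by
  have hprod : (α.prod fun i n => (Polynomial.monomial 1 (monomial (m i) (1 : k))) ^ n) =
      Polynomial.monomial α.degree (monomial (Finsupp.linearCombination ℕ m α) 1) := by
    induction α using Finsupp.induction_linear with
    | zero => simp
    | add f g hf hg =>
      rw [Finsupp.prod_add_index' (fun _ => pow_zero _) (fun _ _ _ => pow_add _ _ _), hf, hg,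
        Polynomial.monomial_mul_monomial, monomial_mul, mul_one, map_add, map_add]
    | single i c => simp [Polynomial.monomial_pow, monomial_pow]
  rw [monomialReesMap, biMonomial, aeval_monomial, hprod, Polynomial.algebraMap_apply,
    Algebra.algebraMap_self, RingHom.id_apply, Polynomial.C_mul_monomial, monomial_mul, mul_one]

/-- The kernel of a map of monomials is contained in every ideal that identifies monomials with
the same image. -/
theorem mem_of_monomialReesMap_eq_zero {k : Type*} [Field k] {V : Type*} {r : ℕ}
    (m : Fin r → V →₀ ℕ) (K : Ideal (MvPolynomial (Fin r) (MvPolynomial V k)))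
    (hK : ∀ (α β : Fin r →₀ ℕ) (p q : V →₀ ℕ), α.degree = β.degree →
      p + Finsupp.linearCombination ℕ m α = q + Finsupp.linearCombination ℕ m β →
      biMonomial k α p - biMonomial k β q ∈ K)
    {F : MvPolynomial (Fin r) (MvPolynomial V k)} (hF : monomialReesMap k m F = 0) : F ∈ K := by
  let w : (Fin r →₀ ℕ) × (V →₀ ℕ) → ℕ × (V →₀ ℕ) := fun x =>
    (x.1.degree, x.2 + Finsupp.linearCombination ℕ m x.1)
  let cls : (Fin r →₀ ℕ) × (V →₀ ℕ) → MvPolynomial (Fin r) (MvPolynomial V k) ⧸ K := fun x =>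
    Ideal.Quotient.mk K (biMonomial k x.1 x.2)
  have hcls : cls.FactorsThrough w := fun x y hxy => by
    obtain ⟨h1, h2⟩ := Prod.ext_iff.mp hxy
    exact Ideal.Quotient.eq.mpr (hK _ _ _ _ h1 h2)
  -- A `k`-linear map sending each monomial of `R[t]` to the class modulo `K` of any monomial above
  -- it, and to `0` if there is none. Composed with the Rees map it is the quotient map, so the
  -- kernel lies in `K`.
  let Φ : Polynomial (MvPolynomial V k) →ₗ[k] MvPolynomial (Fin r) (MvPolynomial V k) ⧸ K :=
    Polynomial.lsum fun d => (basisMonomials V k).constr k fun q =>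
      Function.extend w cls 0 (d, q)
  have hΦ : ∀ d q, Φ (Polynomial.monomial d (monomial q 1)) =
      Function.extend w cls 0 (d, q) := by
    intro d q
    have hsum := Polynomial.sum_monomial_index (monomial q (1 : k))
      (fun d => (basisMonomials V k).constr k fun q => Function.extend w cls 0 (d, q))
      (n := d) (map_zero _)
    refine hsum.trans ?_
    rw [← congrFun (coe_basisMonomials V k) q, Module.Basis.constr_basis]
  have hmk : ∀ F, Φ (monomialReesMap k m F) = Ideal.Quotient.mk K F := by
    intro F
    induction F using MvPolynomial.induction_on' with
    | monomial α c =>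
      induction c using MvPolynomial.induction_on' with
      | monomial p a =>
        have h1 : (monomial α (monomial p a) : MvPolynomial (Fin r) (MvPolynomial V k)) =
            a • biMonomial k α p := by
          rw [biMonomial, smul_monomial, smul_monomial, smul_eq_mul, mul_one]
        have h2 : monomialReesMap k m (a • biMonomial k α p) =
            a • monomialReesMap k m (biMonomial k α p) :=
          map_smul ((monomialReesMap k m).restrictScalars k) a _
        rw [h1, h2, map_smul, monomialReesMap_biMonomial, hΦ]
        have h3 := hcls.extend_apply 0 (α, p)
        simp only [w] at h3
        rw [h3]
        exact (map_smul (Ideal.Quotient.mkₐ k K) a _).symm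
      | add p q hp hq => rw [map_add, map_add, map_add, hp, hq, map_add]
    | add p q hp hq => rw [map_add, map_add, hp, hq, map_add]
  rw [← Ideal.Quotient.eq_zero_iff_mem, ← hmk, hF, map_zero]

theorem mem_reesDefiningIdeal {k : Type*} [Field k] {V : Type*} {G : SimpleGraph V} {r : ℕ}
    (e : Fin r ≃ G.edgeSet) (F : MvPolynomial (Fin r) (MvPolynomial V k)) :
    F ∈ reesDefiningIdeal k e ↔
      monomialReesMap k (fun i => edgeExponent (e i : Sym2 V)) F = 0 := by
  have h : (reesAlgebra (edgeIdeal k G)).val.comp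
      (reesPresentation (edgeIdeal k G) (edgeGenerator k e) (edgeGenerator_mem k e)) =
        monomialReesMap k (fun i => edgeExponent (e i : Sym2 V)) := by
    refine MvPolynomial.algHom_ext fun i => ?_
    simp [reesPresentation, monomialReesMap, edgeGenerator]
  rw [reesDefiningIdeal, RingHom.mem_ker, ← h]
  exact ZeroMemClass.coe_eq_zero.symm

/-! ### The proposed generators vanish in the Rees algebra -/

theorem monomialReesMap_linearForms (k : Type*) [Field k] {V : Type*} {r : ℕ}
    (m : Fin r → V →₀ ℕ) (τ : {τ : Finset (Fin r) // τ.card = 2}) :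
    monomialReesMap k m (linearForms (taylorPresentationMatrix k m) τ) = 0 := by
  obtain ⟨i, j, hij, hτ⟩ := exists_eq_pair τ
  obtain ⟨s, -, h⟩ := linearForms_taylorPresentationMatrix_of_ne k m hij τ hτ
  rw [h, map_mul, map_sub, monomialReesMap_biMonomial, monomialReesMap_biMonomial]
  simp [tsub_add_cancel_of_le (le_sup_left (a := m i) (b := m j)),
    tsub_add_cancel_of_le (le_sup_right (a := m i) (b := m j))]

theorem exists_eq_single_of_degree_eq_one {V : Type*} {f : V →₀ ℕ} (h : f.degree = 1) :
    ∃ v, f = Finsupp.single v 1 := by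
  have hf : f ≠ 0 := by
    rintro rfl
    simp at h
  obtain ⟨v, hv⟩ := Finsupp.ne_iff.mp hf
  obtain ⟨g, rfl⟩ := exists_add_of_le
    (Finsupp.single_le_iff.mpr (Nat.one_le_iff_ne_zero.mpr hv))
  rw [map_add, Finsupp.degree_single, Nat.add_eq_left, Finsupp.degree_eq_zero_iff] at h
  exact ⟨v, by rw [h, add_zero]⟩

theorem mul_map_add_mul_map_zero_sub {A D : Type*} [CommRing A] [CommRing D] (ψ : A →+* D)
    {x y : D} {p q : A} (h : x * ψ p = y * ψ q) : x * ψ p + y * ψ (0 - q) = 0 := by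
  rw [zero_sub, map_neg, mul_neg, h, add_neg_cancel]

/-- The binomial minors of the reduced Jacobian dual of a Taylor matrix of monomials of the same
degree are relations of the Rees algebra. -/
theorem monomialReesMap_binomialMinors {k : Type*} [Field k] {V : Type*} [Fintype V] {r : ℕ}
    {m : Fin r → V →₀ ℕ} (hm : Function.Injective m) {d : ℕ} (hdeg : ∀ i, (m i).degree = d)
    {B : Matrix V {τ : Finset (Fin r) // τ.card = 2} (MvPolynomial (Fin r) (MvPolynomial V k))}
    (hB : IsJacobianDual (taylorPresentationMatrix k m) B) {t : ℕ}
    {q : MvPolynomial (Fin r) k} (hq : q ∈ binomialMinors (reducedMatrix B) t) :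
    monomialReesMap k m (MvPolynomial.map C q) = 0 := by
  classical
  obtain ⟨hbin, f, g, rfl⟩ := hq
  refine (det_submatrix_eq_zero_or_isSignedMonomial
    ((monomialReesMap k m).toRingHom.comp (MvPolynomial.map C)) (fun v => Polynomial.C (X v))
    (fun v => by simp) (reducedMatrix B) ?_ t f f.injective g).resolve_right
    hbin.not_isSignedMonomial
  intro τ
  obtain ⟨i, j, hij, hτ⟩ := exists_eq_pair τ
  obtain ⟨s, hs, hcol⟩ := reducedMatrix_pair hB hij τ hτ
  have hi : m i ⊔ m j - m i + m i = m i ⊔ m j := tsub_add_cancel_of_le le_sup_left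
  have hj : m i ⊔ m j - m j + m j = m i ⊔ m j := tsub_add_cancel_of_le le_sup_right
  -- Equal degrees of the generators make both cofactors of the lcm variables or neither, so no
  -- column has exactly one nonzero entry.
  have hd : (m i ⊔ m j - m i).degree = (m i ⊔ m j - m j).degree := by
    have h1 := congrArg Finsupp.degree (hi.trans hj.symm)
    rw [map_add, map_add, hdeg, hdeg] at h1
    omega
  by_cases ha : ∃ a, m i ⊔ m j - m i = Finsupp.single a 1
  · right
    obtain ⟨a, ha⟩ := ha
    obtain ⟨b, hb⟩ : ∃ b, m i ⊔ m j - m j = Finsupp.single b 1 := by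
      rw [ha, Finsupp.degree_single] at hd
      exact exists_eq_single_of_degree_eq_one hd.symm
    have hab : a ≠ b := by
      rintro rfl
      rw [ha] at hi
      rw [hb, ← hi, add_right_inj] at hj
      exact hij (hm hj).symm
    simp only [ha, hb, (Finsupp.single_left_injective (α := V) one_ne_zero).eq_iff] at hcol
    refine ⟨a, b, hab, ?_, ?_, ?_, ?_⟩
    · intro v h1 h2
      rw [hcol, if_neg h1.symm, if_neg h2.symm, sub_zero]
    · rw [hcol, if_pos rfl, if_neg hab.symm, sub_zero]
      exact ⟨_, s, hs, rfl⟩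
    · rw [hcol, if_pos rfl, if_neg hab, zero_sub, ← map_neg]
      exact ⟨_, -s, by rcases hs with rfl | rfl <;> simp, rfl⟩
    · rw [hcol, hcol, if_pos rfl, if_pos rfl, if_neg hab, if_neg hab.symm, sub_zero]
      refine mul_map_add_mul_map_zero_sub _ ?_
      have hgen : ∀ (l : Fin r) (v : V), Polynomial.C (X v) *
          ((monomialReesMap k m).toRingHom.comp (MvPolynomial.map C))
            (monomial (Finsupp.single l 1) s) =
          Polynomial.C (C s) * Polynomial.monomial 1 (monomial (Finsupp.single v 1 + m l) 1) := by
        intro l v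
        have h1 : MvPolynomial.map (C : k →+* MvPolynomial V k)
            (monomial (Finsupp.single l 1) s) = C (C s) * biMonomial k (Finsupp.single l 1) 0 := by
          simp [biMonomial, C_mul_monomial, monomial_zero']
        rw [RingHom.comp_apply, h1, map_mul]
        change _ * (monomialReesMap k m _ * monomialReesMap k m _) = _
        rw [monomialReesMap_biMonomial]
        simp [monomialReesMap, X, Polynomial.C_mul_monomial, monomial_mul, C_mul_monomial]
      rw [hgen, hgen, ← ha, ← hb, hi, hj]
  · left
    intro v
    rw [hcol, if_neg fun h => ha ⟨v, h⟩, if_neg, sub_zero]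
    intro hb
    apply ha
    rw [hb, Finsupp.degree_single] at hd
    exact exists_eq_single_of_degree_eq_one hd

theorem mainTheorem2 {k : Type*} [Field k] {V : Type*} [Fintype V] (G : SimpleGraph V)
    {r : ℕ} (e : Fin r ≃ G.edgeSet)
    (B : Matrix V {τ : Finset (Fin r) // τ.card = 2} (MvPolynomial (Fin r) (MvPolynomial V k)))
    (hB : IsJacobianDual (edgeTaylorMatrix k e) B) :
    reesDefiningIdeal k e =
      Ideal.span (Set.range (linearForms (edgeTaylorMatrix k e)) ∪
        ⋃ t ∈ Set.Icc 2 (reducedMatrix B).rank,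
          MvPolynomial.map MvPolynomial.C '' binomialMinors (reducedMatrix B) t) := by
  have hinj := edgeExponent_injective e
  apply le_antisymm
  · set K := Ideal.span (Set.range (linearForms (edgeTaylorMatrix k e)) ∪
        ⋃ t ∈ Set.Icc 2 (reducedMatrix B).rank,
          MvPolynomial.map MvPolynomial.C '' binomialMinors (reducedMatrix B) t) with hK
    intro F hF
    rw [mem_reesDefiningIdeal] at hF
    refine mem_of_monomialReesMap_eq_zero _ K (fun α β p q hd h => ?_) hF
    refine biMonomial_sub_mem (fun i v => edgeExponent_eq_of_apply_ne_zero (e i).2)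
      (fun i => degree_edgeExponent _) K ?_ ?_ hd h
    · intro i j
      rcases eq_or_ne i j with rfl | hij
      · simp
      obtain ⟨s, hs, hL⟩ := linearForms_taylorPresentationMatrix_of_ne k
        (fun i => edgeExponent (e i : Sym2 V)) hij ⟨{i, j}, Finset.card_pair hij⟩ rfl
      have hmem : linearForms (edgeTaylorMatrix k e) ⟨{i, j}, Finset.card_pair hij⟩ ∈ K :=
        Ideal.subset_span (Or.inl ⟨_, rfl⟩)
      rw [edgeTaylorMatrix, hL] at hmem
      have h2 := K.mul_mem_left (C (C s)) hmem
      have hss : s * s = 1 := by rcases hs with rfl | rfl <;> simp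
      rwa [← mul_assoc, ← map_mul, ← map_mul, hss, map_one, map_one, one_mul] at h2
    · intro t p u a b htr
      refine htr.sub_mem hinj hB K fun t ht q hq => Ideal.subset_span (Or.inr ?_)
      exact Set.mem_biUnion ht ⟨q, hq, rfl⟩
  · rw [Ideal.span_le]
    rintro F (⟨τ, rfl⟩ | hF)
    · exact (mem_reesDefiningIdeal e _).mpr (monomialReesMap_linearForms k _ τ)
    · obtain ⟨t, -, q, hq, rfl⟩ := Set.mem_iUnion₂.mp hF
      exact (mem_reesDefiningIdeal e _).mpr
        (monomialReesMap_binomialMinors hinj (fun i => degree_edgeExponent _) hB hq)
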